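/- Let $R$ be a finite group with neutral element $e$, let $X=R$ (as a set), and let $X^\ast$ be the rooted tree of finite words over $X$, on which rooted tree automorphisms act from the left. For an automorphism $g$ and a vertex $v$, the section $g|_v$ is the automorphism with $g(vu)=g(v)\,g|_v(u)$ for all words $u$. Regard $R$ as a subgroup of $\operatorname{Aut}(X^\ast)$ by letting $r\in R$ act as the rooted automorphism $x_1x_2\cdots x_n\mapsto (rx_1)x_2\cdots x_n$. An automorphism $d$ is called directed if it fixes every letter $x \in X$, satisfies $d|_e=d$, and $d|_x\in R$ for all $x\in X\setminus\{e\}$. Let $D\le\operatorname{Aut}(X^\ast)$ be a group of directed automorphisms such that $\langle d|_x \mid d\in D,\ x\in X\setminus\{e\}\rangle=R$; then $G=\langle R\cup D\rangle$ is called a constant spinal group. For $n \ge 0$ let $\operatorname{St}_G(n)$ be the pointwise stabiliser in $G$ of the set $X^n$ of words of length $n$. For a family $(h_x)_{x\in X}$ of automorphisms let $\psi((h_x)_{x\in X})$ be the automorphism that fixes every letter $x \in X$ and has section $h_x$ at $x$. The group $G$ is called layered if it is self-similar (it contains all sections of its elements) and regular branch over itself, i.e. $\psi(G^X)$ is contained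 in $G$ as a subgroup of finite index. The group $G$ has the congruence subgroup property if every normal subgroup of finite index of $G$ contains $\operatorname{St}_G(n)$ for some $n$. Proposition. Let $G=\langle R\cup D\rangle$ be a layered constant spinal group. Then $G$ has the congruence subgroup property if and only if $G$ is perfect, i.e. equal to its commutator subgroup. -/

import Mathlib

/-!
Automorphisms of the regular rooted tree `X^*`, whose vertices are the finite words `List X`, the
root is the empty word and `u` is the predecessor of `u ++ [x]`.
-/

namespace SpinalTree

/-- The group of automorphisms of the rooted tree `X^*`: the permutations of the set of words that
preserve the length (the layers) and the prefix relation. -/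
def treeAut (X : Type*) : Subgroup (Equiv.Perm (List X)) where
  carrier := {g | (∀ u, (g u).length = u.length) ∧ ∀ u v, u <+: v → g u <+: g v}
  one_mem' := ⟨fun _ => rfl, fun _ _ h => h⟩
  mul_mem' := by
    rintro f g ⟨hf, hf'⟩ ⟨hg, hg'⟩
    exact ⟨fun u => by simp [hf, hg], fun u v h => hf' _ _ (hg' _ _ h)⟩
  inv_mem' := by
    rintro g ⟨hg, hg'⟩
    have hl : ∀ u, (g⁻¹ u).length = u.length := fun u => by
      have h := hg (g⁻¹ u)
      rw [show g (g⁻¹ u) = u from g.apply_symm_apply u] at h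
      exact h.symm
    refine ⟨hl, fun u v h => ?_⟩
    have h1 : g ((g⁻¹ v).take u.length) <+: v := by
      have h := hg' _ _ (List.take_prefix u.length (g⁻¹ v))
      rwa [show g (g⁻¹ v) = v from g.apply_symm_apply v] at h
    have h2 : (g ((g⁻¹ v).take u.length)).length = u.length := by
      rw [hg, List.length_take, hl]
      exact min_eq_left h.length_le
    have h3 : g ((g⁻¹ v).take u.length) = u :=
      (List.prefix_of_prefix_length_le h1 h h2.le).eq_of_length h2
    have h4 : g⁻¹ u = (g⁻¹ v).take u.length := by
      rw [Equiv.Perm.inv_eq_iff_eq, h3]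
    rw [h4]
    exact List.take_prefix _ _

/-- `Aut(X^*)` as a type; elements act on words from the left and `f * g` is `f` after `g`. -/
abbrev TreeAut (X : Type*) := treeAut X

variable {X : Type*}

/-- The image of the vertex `u` under `g`. -/
def act (g : TreeAut X) (u : List X) : List X := (g : Equiv.Perm (List X)) u

theorem act_append (g : TreeAut X) (v u : List X) :
    act g (v ++ u) = act g v ++ (act g (v ++ u)).drop v.length := by
  obtain ⟨t, ht⟩ := g.2.2 v (v ++ u) (List.prefix_append v u)
  have hl : (act g v).length = v.length := g.2.1 v
  change act g v ++ t = act g (v ++ u) at ht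
  rw [← ht, List.drop_append, ← hl]
  simp

theorem act_inv_act (g : TreeAut X) (u : List X) : act g⁻¹ (act g u) = u := by
  simp [act]

theorem act_act_inv (g : TreeAut X) (u : List X) : act g (act g⁻¹ u) = u := by
  simp [act]

theorem length_act (g : TreeAut X) (u : List X) : (act g u).length = u.length := g.2.1 u

/-- The section `g|_v` of `g` at the vertex `v`: the automorphism with
`g (v ++ u) = g v ++ g|_v u` for all `u`, see `act_append_eq`. -/
def sectionAt (g : TreeAut X) (v : List X) : TreeAut X :=
  ⟨{ toFun := fun u => (act g (v ++ u)).drop v.length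
     invFun := fun u => (act g⁻¹ (act g v ++ u)).drop v.length
     left_inv := fun u => by
       change (act g⁻¹ (act g v ++ (act g (v ++ u)).drop v.length)).drop v.length = u
       rw [← act_append, act_inv_act, List.drop_left]
     right_inv := fun u => by
       have h := act_append g⁻¹ (act g v) u
       rw [act_inv_act, length_act] at h
       change (act g (v ++ (act g⁻¹ (act g v ++ u)).drop v.length)).drop v.length = u
       rw [← h, act_act_inv, ← length_act g v, List.drop_left] },
   by
    refine ⟨fun u => ?_, fun u w h => ?_⟩
    · change ((act g (v ++ u)).drop v.length).length = u.length
      rw [List.length_drop, length_act, List.length_append]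
      omega
    · change (act g (v ++ u)).drop v.length <+: (act g (v ++ w)).drop v.length
      have h1 : act g (v ++ u) <+: act g (v ++ w) :=
        g.2.2 _ _ ((List.prefix_append_right_inj v).2 h)
      rw [act_append g v u, act_append g v w] at h1
      exact (List.prefix_append_right_inj _).1 h1⟩

theorem act_append_eq (g : TreeAut X) (v u : List X) :
    act g (v ++ u) = act g v ++ act (sectionAt g v) u := act_append g v u

/-- The pointwise stabiliser `St(n)` of the `n`-th layer. -/
def layerStabilizer (X : Type*) (n : ℕ) : Subgroup (TreeAut X) where
  carrier := {g | ∀ u : List X, u.length = n → act g u = u}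
  one_mem' := fun _ _ => rfl
  mul_mem' := by
    intro f g hf hg u hu
    change act f (act g u) = u
    rw [hg u hu, hf u hu]
  inv_mem' := by
    intro g hg u hu
    have h := act_inv_act g u
    rwa [hg u hu] at h

/-- The word map of the rooted automorphism given by a map `s` on letters: only the first letter of
a word is changed. -/
def rootedMap (s : X → X) : List X → List X
  | [] => []
  | x :: w => s x :: w

/-- The embedding of `Sym(X)` into `Aut(X^*)` as the group of rooted automorphisms. -/
def rooted (X : Type*) : Equiv.Perm X →* TreeAut X where
  toFun s :=
    ⟨{ toFun := rootedMap s
       invFun := rootedMap s.symm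
       left_inv := by rintro (_ | ⟨x, w⟩) <;> simp [rootedMap]
       right_inv := by rintro (_ | ⟨x, w⟩) <;> simp [rootedMap] },
     by
      refine ⟨?_, ?_⟩
      · rintro (_ | ⟨x, w⟩) <;> simp [rootedMap]
      · rintro (_ | ⟨x, w⟩) (_ | ⟨y, v⟩) h <;>
          simp_all [rootedMap, List.cons_prefix_cons]⟩
  map_one' := by
    apply Subtype.ext
    apply Equiv.ext
    rintro (_ | ⟨x, w⟩) <;> rfl
  map_mul' s t := by
    apply Subtype.ext
    apply Equiv.ext
    rintro (_ | ⟨x, w⟩) <;> rfl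

/-- The word map of the automorphism `(x : h x)_{x ∈ X}`. -/
def baseMap (h : X → List X → List X) : List X → List X
  | [] => []
  | x :: w => x :: h x w

/-- The embedding `ψ` of `Aut(X^*)^X` into `Aut(X^*)` with image `St(1)`: the automorphism `ψ h`
fixes the first layer pointwise and has the section `h x` at every letter `x`. -/
def baseEmbedding (X : Type*) : (X → TreeAut X) →* TreeAut X where
  toFun h :=
    ⟨{ toFun := baseMap fun x => act (h x)
       invFun := baseMap fun x => act (h x)⁻¹
       left_inv := by rintro (_ | ⟨x, w⟩) <;> simp [baseMap, act_inv_act]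
       right_inv := by rintro (_ | ⟨x, w⟩) <;> simp [baseMap, act_act_inv] },
     by
      refine ⟨?_, ?_⟩
      · rintro (_ | ⟨x, w⟩) <;> simp [baseMap, length_act]
      · rintro (_ | ⟨x, w⟩) (_ | ⟨y, v⟩) hp
        · simp [baseMap]
        · simp [baseMap]
        · simp at hp
        · obtain ⟨rfl, hwv⟩ := List.cons_prefix_cons.1 hp
          exact List.cons_prefix_cons.2 ⟨rfl, (h x).2.2 _ _ hwv⟩⟩
  map_one' := by
    apply Subtype.ext
    apply Equiv.ext
    rintro (_ | ⟨x, w⟩) <;> rfl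
  map_mul' s t := by
    apply Subtype.ext
    apply Equiv.ext
    rintro (_ | ⟨x, w⟩) <;> rfl

/-- `G` is self-similar: it contains all sections of its elements. -/
def IsSelfSimilar (G : Subgroup (TreeAut X)) : Prop :=
  ∀ g ∈ G, ∀ v : List X, sectionAt g v ∈ G

/-- The subgroup `ψ(H^X)` of `Aut(X^*)`. -/
def geometricPower (H : Subgroup (TreeAut X)) : Subgroup (TreeAut X) :=
  (Subgroup.pi Set.univ fun _ : X => H).map (baseEmbedding X)

/-- `G` is regular branch over its finite index subgroup `K`: the group `ψ(K^X)` is contained in `K`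
as a finite index subgroup. -/
def IsRegularBranchOver (G K : Subgroup (TreeAut X)) : Prop :=
  K ≤ G ∧ K.IsFiniteRelIndex G ∧ geometricPower K ≤ K ∧ (geometricPower K).IsFiniteRelIndex K

/-- A layered group is a self-similar group that is regular branch over itself. -/
def IsLayered (G : Subgroup (TreeAut X)) : Prop :=
  IsSelfSimilar G ∧ IsRegularBranchOver G G

/-- The congruence subgroup property: every normal subgroup of finite index of `G` contains
`St_G(n) = St(n) ∩ G` for some `n`. -/
def HasCongruenceSubgroupProperty (G : Subgroup (TreeAut X)) : Prop :=
  ∀ N : Subgroup G, N.Normal → N.FiniteIndex →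
    ∃ n : ℕ, (layerStabilizer X n).subgroupOf G ≤ N

/-- The group `R` as a group of rooted automorphisms of the tree `R^*`: the element `r` multiplies
the first letter of a word by `r` from the left. -/
def rootedGroup (R : Type*) [Group R] : Subgroup (TreeAut R) :=
  ((rooted R).comp (MulAction.toPermHom R R)).range

/-- Directed automorphisms `d` of `R^*`: they fix the first layer pointwise, act on the subtree at
the letter `1` again by `d`, and act on the subtrees at all other letters by rooted automorphisms
from `R`. -/
def IsDirected {R : Type*} [Group R] (d : TreeAut R) : Prop :=
  d ∈ layerStabilizer R 1 ∧ sectionAt d [1] = d ∧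
    ∀ x : R, x ≠ 1 → sectionAt d [x] ∈ rootedGroup R

/-- `G` is a constant spinal group with rooted group `R` and directed group `D`: the group `D`
consists of directed automorphisms, the sections of its elements at the letters different from `1`
generate `R`, and `G` is generated by `R` and `D`. -/
structure IsConstantSpinal {R : Type*} [Group R] (G D : Subgroup (TreeAut R)) : Prop where
  directed : ∀ d ∈ D, IsDirected d
  generation : Subgroup.closure {h | ∃ d ∈ D, ∃ x : R, x ≠ 1 ∧ sectionAt d [x] = h} = rootedGroup R
  eq_closure : G = Subgroup.closure ((rootedGroup R : Set (TreeAut R)) ∪ (D : Set (TreeAut R)))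

end SpinalTree

namespace SpinalTree

open scoped commutatorElement

/-! ### Sections, layer stabilisers and the base embedding -/

section Tree

variable {X : Type*}

/-! If `G` is perfect, let `N` be a nontrivial normal subgroup and `g ∈ N` with `g v ≠ v`. Copies
`A`, `B` of elements of `G` at `v` lie in `G`, and `A` conjugated by `g` lives at `g v`, so it
commutes with `B`. Hence `⁅⁅A, g⁆, B⁆ = ⁅A, B⁆` lies in `N`: thus `N` contains the copy at `v` of
`G' = G`, by transitivity the copies at the whole layer of `v`, and by self-similarity the
stabiliser of that layer.

Conversely, `G` is generated by two finite groups, so `G'` has finite index and the congruence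
property gives `St_G(n) ≤ G'`. Multiplying the classes of the first-layer sections is a homomorphism
from `G` to its abelianization; it sends the copy of `g` at a letter to the class of `g`. So `St_G(n
+ 1) ≤ G'` forces `St_G(n) ≤ G'`, and descent to `n = 0` gives `G = G'`. -/

theorem ext_act {g h : TreeAut X} (H : ∀ u, act g u = act h u) : g = h :=
  Subtype.ext (Equiv.ext H)

theorem act_mul (g h : TreeAut X) (u : List X) : act (g * h) u = act g (act h u) := rfl

theorem act_one (u : List X) : act (1 : TreeAut X) u = u := rfl

theorem act_nil (g : TreeAut X) : act g [] = [] :=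
  List.eq_nil_of_length_eq_zero (by rw [length_act, List.length_nil])

theorem sectionAt_mul (g h : TreeAut X) (v : List X) :
    sectionAt (g * h) v = sectionAt g (act h v) * sectionAt h v := by
  refine ext_act fun u => ?_
  have h1 := act_append_eq (g * h) v u
  rw [act_mul, act_mul, act_append_eq h, act_append_eq g] at h1
  exact (List.append_cancel_left h1).symm

theorem act_baseEmbedding_cons (h : X → TreeAut X) (x : X) (u : List X) :
    act (baseEmbedding X h) (x :: u) = x :: act (h x) u := rfl

theorem sectionAt_baseEmbedding (h : X → TreeAut X) (x : X) :
    sectionAt (baseEmbedding X h) [x] = h x := by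
  refine ext_act fun u => ?_
  have h1 := act_append_eq (baseEmbedding X h) [x] u
  have h2 : act (baseEmbedding X h) [x] = [x] := by
    rw [act_baseEmbedding_cons, act_nil]
  rw [h2, List.singleton_append, List.singleton_append, act_baseEmbedding_cons] at h1
  exact (List.cons_injective h1).symm

theorem layerStabilizer_mono {m n : ℕ} (hmn : m ≤ n) (hX : Nonempty X) :
    layerStabilizer X n ≤ layerStabilizer X m := by
  intro g hg u hu
  obtain ⟨x⟩ := hX
  have h1 := hg (u ++ List.replicate (n - m) x) (by simp [hu, hmn])
  rw [act_append_eq] at h1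
  exact (List.append_inj h1 (length_act g u)).1

theorem eq_baseEmbedding_of_mem_layerStabilizer {g : TreeAut X} (hg : g ∈ layerStabilizer X 1) :
    g = baseEmbedding X fun x => sectionAt g [x] := by
  refine ext_act fun u => ?_
  rcases u with _ | ⟨x, u⟩
  · rw [act_nil, act_nil]
  · rw [act_baseEmbedding_cons, ← List.singleton_append, act_append_eq, hg [x] rfl,
      List.singleton_append]

theorem sectionAt_mem_layerStabilizer {g : TreeAut X} {n : ℕ}
    (hg : g ∈ layerStabilizer X (n + 1)) (x : X) : sectionAt g [x] ∈ layerStabilizer X n := by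
  intro u hu
  have h1 := hg ([x] ++ u) (by simp [hu])
  rw [act_append_eq] at h1
  exact (List.append_inj h1 (length_act g _)).2

theorem mem_layerStabilizer_zero (g : TreeAut X) : g ∈ layerStabilizer X 0 := fun u hu => by
  rw [List.eq_nil_of_length_eq_zero hu, act_nil]

theorem baseEmbedding_mem {G : Subgroup (TreeAut X)} (hG : geometricPower G ≤ G)
    {h : X → TreeAut X} (hh : ∀ x, h x ∈ G) : baseEmbedding X h ∈ G :=
  hG (Subgroup.mem_map_of_mem _ fun x _ => hh x)

/-! ### Copies of a group at a vertex; perfect implies congruence property -/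

section Single

variable [DecidableEq X]

/-- The automorphism acting by `h` on the subtree at the vertex `v` and trivially elsewhere, as a
homomorphism in `h`. -/
def singleAt : List X → TreeAut X →* TreeAut X
  | [] => MonoidHom.id _
  | x :: v => (baseEmbedding X).comp ((MonoidHom.mulSingle (fun _ : X => TreeAut X) x).comp
      (singleAt v))

theorem singleAt_nil (h : TreeAut X) : singleAt [] h = h := rfl

theorem singleAt_cons (x : X) (v : List X) (h : TreeAut X) :
    singleAt (x :: v) h = baseEmbedding X (Pi.mulSingle x (singleAt v h)) := rfl

theorem act_singleAt_append (v u : List X) (h : TreeAut X) :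
    act (singleAt v h) (v ++ u) = v ++ act h u := by
  induction v with
  | nil => rfl
  | cons x v ih =>
    rw [singleAt_cons, List.cons_append, act_baseEmbedding_cons, Pi.mulSingle_eq_same, ih,
      List.cons_append]

theorem act_singleAt_of_not_prefix {v w : List X} (h : TreeAut X) (hvw : ¬ v <+: w) :
    act (singleAt v h) w = w := by
  induction v generalizing w with
  | nil => exact absurd List.nil_prefix hvw
  | cons x v ih =>
    rcases w with _ | ⟨y, w⟩
    · exact act_nil _
    · rw [singleAt_cons, act_baseEmbedding_cons]
      by_cases hxy : y = x
      · subst hxy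
        rw [Pi.mulSingle_eq_same, ih fun hp => hvw (List.cons_prefix_cons.2 ⟨rfl, hp⟩)]
      · rw [Pi.mulSingle_eq_of_ne hxy, act_one]

/-- Below `v` this is the defining property of the section; elsewhere both copies act trivially,
since `g` preserves non-prefixes. -/
theorem mul_singleAt (g h : TreeAut X) (v : List X) :
    g * singleAt v h =
      singleAt (act g v) (sectionAt g v * h * (sectionAt g v)⁻¹) * g := by
  refine ext_act fun w => ?_
  rw [act_mul, act_mul]
  by_cases hvw : v <+: w
  · obtain ⟨u, rfl⟩ := hvw
    rw [act_singleAt_append, act_append_eq, act_append_eq, act_singleAt_append, ← act_mul,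
      ← act_mul, inv_mul_cancel_right]
  · have h1 : ¬ act g v <+: act g w := fun hp => hvw <| by
      have := g⁻¹.2.2 _ _ hp
      change act g⁻¹ (act g v) <+: act g⁻¹ (act g w) at this
      rwa [act_inv_act, act_inv_act] at this
    rw [act_singleAt_of_not_prefix _ hvw, act_singleAt_of_not_prefix _ h1]

theorem conj_singleAt (g h : TreeAut X) (v : List X) :
    g * singleAt v h * g⁻¹ =
      singleAt (act g v) (sectionAt g v * h * (sectionAt g v)⁻¹) := by
  rw [mul_singleAt, mul_inv_cancel_right]

/-- Distinct vertices of one layer span disjoint subtrees. -/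
theorem commute_singleAt {v w : List X} (hl : v.length = w.length) (hvw : v ≠ w)
    (a b : TreeAut X) : Commute (singleAt v a) (singleAt w b) := by
  induction v generalizing w with
  | nil => exact absurd (List.eq_nil_of_length_eq_zero hl.symm).symm hvw
  | cons x v ih =>
    rcases w with _ | ⟨y, w⟩
    · simp at hl
    · rw [singleAt_cons, singleAt_cons]
      refine Commute.map ?_ (baseEmbedding X)
      by_cases hxy : x = y
      · subst hxy
        exact (ih (by simpa using hl) fun h => hvw (h ▸ rfl)).map
          (MonoidHom.mulSingle (fun _ : X => TreeAut X) x)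
      · exact Pi.mulSingle_commute hxy _ _

theorem singleAt_mem {G : Subgroup (TreeAut X)} (hG : geometricPower G ≤ G)
    (v : List X) {h : TreeAut X} (hh : h ∈ G) : singleAt v h ∈ G := by
  induction v with
  | nil => exact hh
  | cons x v ih =>
    rw [singleAt_cons]
    refine baseEmbedding_mem hG fun y => ?_
    by_cases hy : y = x
    · subst hy
      simpa using ih
    · rw [Pi.mulSingle_eq_of_ne hy]
      exact one_mem G

/-- In a self-similar group, a subgroup containing the copies of the group at all vertices of the
`n`-th layer contains the stabiliser of that layer. -/
theorem mem_of_singleAt_mem [Finite X] [Nonempty X] {G : Subgroup (TreeAut X)}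
    (hG : IsSelfSimilar G) (n : ℕ) {K : Subgroup (TreeAut X)}
    (hK : ∀ v : List X, v.length = n → ∀ h ∈ G, singleAt v h ∈ K) {g : TreeAut X} (hg : g ∈ G)
    (hgn : g ∈ layerStabilizer X n) : g ∈ K := by
  induction n generalizing K g with
  | zero => exact hK [] rfl g hg
  | succ n ih =>
    rw [eq_baseEmbedding_of_mem_layerStabilizer
      (layerStabilizer_mono (Nat.le_add_left 1 n) inferInstance hgn), ← Subgroup.mem_comap]
    refine Subgroup.pi_mem_of_mulSingle_mem _ fun x => ?_
    -- The induction runs on the preimage of `K` under the copy at `x`, which is why `K` is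
    -- generalised.
    refine ih (K := (K.comap (baseEmbedding X)).comap
      (MonoidHom.mulSingle (fun _ : X => TreeAut X) x)) (fun v hv h hh => ?_) (hG g hg [x])
      (sectionAt_mem_layerStabilizer hgn x)
    exact hK (x :: v) (by simp [hv]) h hh

theorem singleAt_singleton_mem_layerStabilizer {g : TreeAut X} {n : ℕ}
    (hg : g ∈ layerStabilizer X n) (x : X) : singleAt [x] g ∈ layerStabilizer X (n + 1) := by
  rintro (_ | ⟨y, u⟩) hu
  · exact act_nil _
  · rw [singleAt_cons, act_baseEmbedding_cons]
    by_cases hy : y = x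
    · subst hy
      rw [Pi.mulSingle_eq_same, singleAt_nil, hg u (by simpa using hu)]
    · rw [Pi.mulSingle_eq_of_ne hy, act_one]

/-- The copy of a layered group `G` at the vertex `v`, as an endomorphism of `G`. -/
def restrictedSingleAt {G : Subgroup (TreeAut X)} (hG : geometricPower G ≤ G) (v : List X) :
    G →* G :=
  ((singleAt v).comp G.subtype).codRestrict G fun h => singleAt_mem hG v h.2

/-- The double commutator trick: with `C = g * A * g⁻¹`, the element `A * C⁻¹ = ⁅A, g⁆` lies in `N`,
and since `C` commutes with `B`, its commutator with `B` is `⁅A, B⁆`. -/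
theorem commutator_le_comap_restrictedSingleAt {G : Subgroup (TreeAut X)}
    (hG : geometricPower G ≤ G) (N : Subgroup G) [N.Normal] {g : G} (hg : g ∈ N) {v : List X}
    (hv : act g.1 v ≠ v) : commutator G ≤ N.comap (restrictedSingleAt hG v) := by
  rw [commutator_def, Subgroup.commutator_le]
  intro a _ b _
  rw [Subgroup.mem_comap, map_commutatorElement]
  set A := restrictedSingleAt hG v a
  set B := restrictedSingleAt hG v b
  have hcomm : Commute (g * A * g⁻¹) B := by
    apply Subtype.ext
    change g.1 * singleAt v a.1 * g.1⁻¹ * singleAt v b.1 =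
      singleAt v b.1 * (g.1 * singleAt v a.1 * g.1⁻¹)
    rw [conj_singleAt]
    exact commute_singleAt (length_act _ _) hv _ _
  have hk : A * (g * A * g⁻¹)⁻¹ ∈ N := by
    have : A * (g * A * g⁻¹)⁻¹ = A * g * A⁻¹ * g⁻¹ := by group
    rw [this]
    exact N.mul_mem (‹N.Normal›.conj_mem _ hg A) (N.inv_mem hg)
  have hkB := N.mul_mem hk (‹N.Normal›.conj_mem _ (N.inv_mem hk) B)
  have : A * (g * A * g⁻¹)⁻¹ * (B * (A * (g * A * g⁻¹)⁻¹)⁻¹ * B⁻¹) = ⁅A, B⁆ := by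
    generalize g * A * g⁻¹ = C at hcomm ⊢
    calc A * C⁻¹ * (B * (A * C⁻¹)⁻¹ * B⁻¹) = A * C⁻¹ * (B * C) * A⁻¹ * B⁻¹ := by group
      _ = A * C⁻¹ * (C * B) * A⁻¹ * B⁻¹ := by rw [hcomm.eq]
      _ = ⁅A, B⁆ := by rw [commutatorElement_def]; group
  rwa [this] at hkB

/-- A self-similar perfect group that contains its geometric power and acts transitively on all
layers has the congruence subgroup property. -/
theorem hasCongruenceSubgroupProperty_of_isPerfect [Finite X] [Nonempty X]
    {G : Subgroup (TreeAut X)} (hss : IsSelfSimilar G) (hG : geometricPower G ≤ G)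
    (htrans : ∀ v w : List X, v.length = w.length → ∃ g ∈ G, act g v = w)
    (hperf : commutator G = ⊤) : HasCongruenceSubgroupProperty G := by
  intro N hN hfin
  by_cases hbot : N = ⊥
  -- Here `G` is finite, so one layer is deep enough to detect all its nontrivial elements.
  · subst hbot
    have : Finite G := Nat.finite_of_card_ne_zero (Subgroup.index_bot (G := G) ▸ hfin.index_ne_zero)
    have hex : ∀ g : G, ∃ n, g.1 ∈ layerStabilizer X n → g = 1 := by
      intro g
      by_cases h1 : g = 1
      · exact ⟨0, fun _ => h1⟩
      · by_contra! hc
        exact h1 (Subtype.ext (ext_act fun u => (hc u.length).1 u rfl))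
    choose n hn using hex
    obtain ⟨m, hm⟩ := (Set.finite_range n).bddAbove
    exact ⟨m, fun g hg => (Subgroup.mem_bot).2
      (hn g (layerStabilizer_mono (hm ⟨g, rfl⟩) inferInstance (Subgroup.mem_subgroupOf.1 hg)))⟩
  · obtain ⟨g, hg, hg1⟩ := N.bot_or_exists_ne_one.resolve_left hbot
    obtain ⟨v, hv⟩ : ∃ v, act g.1 v ≠ v := by
      by_contra! hc
      exact hg1 (Subtype.ext (ext_act hc))
    have hcop : ∀ h : G, restrictedSingleAt hG v h ∈ N := fun h => by
      have := commutator_le_comap_restrictedSingleAt hG N hg hv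
      rw [hperf] at this
      exact this (Subgroup.mem_top h)
    refine ⟨v.length, fun k hk => ?_⟩
    have hkN : k.1 ∈ N.map G.subtype := by
      refine mem_of_singleAt_mem hss v.length (fun w hw h hh => ?_) k.2
        (Subgroup.mem_subgroupOf.1 hk)
      obtain ⟨t, ht, rfl⟩ := htrans v w hw.symm
      have hs := hss t ht v
      -- Twisting `h` by the section beforehand makes conjugation by `t` yield exactly the copy of
      -- `h` at `t v`.
      let h' : G := ⟨(sectionAt t v)⁻¹ * h * sectionAt t v,
        G.mul_mem (G.mul_mem (G.inv_mem hs) hh) hs⟩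
      refine ⟨_, hN.conj_mem _ (hcop h') ⟨t, ht⟩, ?_⟩
      change t * singleAt v ((sectionAt t v)⁻¹ * h * sectionAt t v) * t⁻¹ = _
      rw [conj_singleAt]
      congr 1
      group
    obtain ⟨k', hk', he⟩ := hkN
    rwa [← Subtype.ext he]

end Single

/-! ### Product of sections in the abelianization; congruence property implies perfect -/

/-- The permutation of the `n`-th layer induced by a tree automorphism. -/
def layerPerm (n : ℕ) (g : TreeAut X) : Equiv.Perm (List.Vector X n) where
  toFun u := ⟨act g u.1, (length_act g u.1).trans u.2⟩
  invFun u := ⟨act g⁻¹ u.1, (length_act g⁻¹ u.1).trans u.2⟩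
  left_inv u := Subtype.ext (act_inv_act g u.1)
  right_inv u := Subtype.ext (act_act_inv g u.1)

/-- The homomorphism from a self-similar group to its abelianization that multiplies the classes of
the sections at the letters. -/
def sectionProd [Fintype X] {G : Subgroup (TreeAut X)} (hG : IsSelfSimilar G) :
    G →* Abelianization G where
  toFun g := ∏ u : List.Vector X 1, Abelianization.of ⟨sectionAt g.1 u.1, hG g.1 g.2 u.1⟩
  map_one' := by
    refine Finset.prod_eq_one fun u _ => ?_
    rw [← map_one (Abelianization.of (G := G))]
    refine congrArg _ (Subtype.ext (ext_act fun w => ?_))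
    exact (List.append_cancel_left (act_append_eq (1 : TreeAut X) u.1 w)).symm
  map_mul' g h := by
    -- The section of `g * h` at `u` involves that of `g` at `h u`; reindexing by the permutation
    -- `h` induces on letters removes the shift.
    rw [← Equiv.prod_comp (layerPerm 1 h.1) fun u : List.Vector X 1 =>
      Abelianization.of (⟨sectionAt g.1 u.1, hG g.1 g.2 u.1⟩ : G), ← Finset.prod_mul_distrib]
    refine Finset.prod_congr rfl fun u _ => ?_
    rw [← map_mul]
    exact congrArg _ (Subtype.ext (sectionAt_mul g.1 h.1 u.1))

theorem sectionProd_singleAt [Fintype X] [DecidableEq X] {G : Subgroup (TreeAut X)}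
    (hss : IsSelfSimilar G) (hG : geometricPower G ≤ G) (x : X) (g : G) :
    sectionProd hss (restrictedSingleAt hG [x] g) = Abelianization.of g := by
  refine (Fintype.prod_eq_single (α := List.Vector X 1) ⟨[x], rfl⟩ ?_).trans ?_
  · rintro ⟨u, hu⟩ hne
    obtain ⟨y, rfl⟩ := List.length_eq_one_iff.1 hu
    rw [← map_one (Abelianization.of (G := G))]
    refine congrArg _ (Subtype.ext ?_)
    change sectionAt (baseEmbedding X (Pi.mulSingle x g.1)) [y] = 1
    have hy : y ≠ x := by
      rintro rfl
      exact hne rfl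
    rw [sectionAt_baseEmbedding, Pi.mulSingle_eq_of_ne hy]
  · refine congrArg _ (Subtype.ext ?_)
    change sectionAt (baseEmbedding X (Pi.mulSingle x g.1)) [x] = g.1
    rw [sectionAt_baseEmbedding, Pi.mulSingle_eq_same]

/-- Descent on `n`: the copy at `x` of an element of `St_G(n)` lies in `St_G(n + 1)`, and
`sectionProd` recovers the class of that element. -/
theorem commutator_eq_top_of_layerStabilizer_le [Finite X] [Nonempty X]
    {G : Subgroup (TreeAut X)} (hss : IsSelfSimilar G) (hG : geometricPower G ≤ G) (n : ℕ)
    (hn : (layerStabilizer X n).subgroupOf G ≤ commutator G) : commutator G = ⊤ := by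
  classical
  have := Fintype.ofFinite X
  obtain ⟨x⟩ := ‹Nonempty X›
  induction n with
  | zero =>
    exact top_le_iff.1 fun g _ => hn (Subgroup.mem_subgroupOf.2 (mem_layerStabilizer_zero g.1))
  | succ n ih =>
    refine ih fun g hg => ?_
    have h1 : restrictedSingleAt hG [x] g ∈ commutator G :=
      hn (Subgroup.mem_subgroupOf.2
        (singleAt_singleton_mem_layerStabilizer (Subgroup.mem_subgroupOf.1 hg) x))
    have h2 := Abelianization.commutator_subset_ker (sectionProd hss) h1
    rw [MonoidHom.mem_ker, sectionProd_singleAt] at h2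
    rwa [← Abelianization.ker_of, MonoidHom.mem_ker]

end Tree

/-! ### Finite abelianization and transitivity of constant spinal groups -/

section ConstantSpinal

variable {R : Type*} [Group R]

/-- A directed automorphism repeats itself at `1`, so its sections at the other letters determine it
by induction on words; these lie in a finite group. -/
theorem finite_of_isDirected [Finite R] (D : Subgroup (TreeAut R)) (hD : ∀ d ∈ D, IsDirected d) :
    Finite D := by
  have : Finite (rootedGroup R) :=
    Finite.of_surjective _
      ((rooted R).comp (MulAction.toPermHom R R)).rangeRestrict_surjective
  let f : D → ({x : R // x ≠ 1} → rootedGroup R) :=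
    fun d x => ⟨sectionAt d.1 [x.1], (hD d.1 d.2).2.2 x.1 x.2⟩
  refine Finite.of_injective f fun a b hab => Subtype.ext (ext_act fun u => ?_)
  induction u with
  | nil => rw [act_nil, act_nil]
  | cons x u ih =>
    rw [← List.singleton_append, act_append_eq, act_append_eq, (hD a.1 a.2).1 [x] rfl,
      (hD b.1 b.2).1 [x] rfl]
    by_cases hx : x = 1
    · subst hx
      rw [(hD a.1 a.2).2.1, (hD b.1 b.2).2.1, ih]
    · have := congrArg Subtype.val (congrFun hab ⟨x, hx⟩)
      change sectionAt a.1 [x] = sectionAt b.1 [x] at this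
      rw [this]

/-- The abelianization of a group generated by two finite subgroups is finite. -/
theorem finite_abelianization_of_closure_union {Γ : Type*} [Group Γ] (A B G : Subgroup Γ)
    [Finite A] [Finite B] (hG : G = Subgroup.closure ((A : Set Γ) ∪ B)) :
    Finite (Abelianization G) := by
  have hAG : A ≤ G := fun a ha => hG ▸ Subgroup.subset_closure (Or.inl ha)
  have hBG : B ≤ G := fun b hb => hG ▸ Subgroup.subset_closure (Or.inr hb)
  -- Commutativity of the target makes this a homomorphism; its image contains the classes of all
  -- generators.
  let f : A × B →* Abelianization G :=
    (Abelianization.of.comp (Subgroup.inclusion hAG)).coprod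
      (Abelianization.of.comp (Subgroup.inclusion hBG))
  have hle : G ≤ (f.range.comap Abelianization.of).map G.subtype := by
    conv_lhs => rw [hG]
    rw [Subgroup.closure_le]
    rintro c (hc | hc)
    · exact ⟨⟨c, hAG hc⟩, ⟨(⟨c, hc⟩, 1), by simp [f]; rfl⟩, rfl⟩
    · exact ⟨⟨c, hBG hc⟩, ⟨(1, ⟨c, hc⟩), by simp [f]; rfl⟩, rfl⟩
  refine Finite.of_surjective f fun q => ?_
  obtain ⟨g, rfl⟩ := QuotientGroup.mk_surjective q
  obtain ⟨g', hg', he⟩ := hle g.2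
  obtain rfl : g' = g := Subtype.ext he
  exact hg'

theorem IsConstantSpinal.finiteIndex_commutator [Finite R] {G D : Subgroup (TreeAut R)}
    (hG : IsConstantSpinal G D) : (commutator G).FiniteIndex := by
  have := finite_of_isDirected D hG.directed
  have : Finite (rootedGroup R) :=
    Finite.of_surjective _
      ((rooted R).comp (MulAction.toPermHom R R)).rangeRestrict_surjective
  have : Finite (G ⧸ commutator G) :=
    finite_abelianization_of_closure_union (rootedGroup R) D G hG.eq_closure
  exact Subgroup.finiteIndex_of_finite_quotient

theorem exists_act_eq_of_rootedGroup_le {G : Subgroup (TreeAut R)} (hR : rootedGroup R ≤ G)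
    (hG : geometricPower G ≤ G) (v w : List R) (hvw : v.length = w.length) :
    ∃ g ∈ G, act g v = w := by
  classical
  induction v generalizing w with
  | nil => exact ⟨1, one_mem G, (List.eq_nil_of_length_eq_zero hvw.symm).symm⟩
  | cons x v ih =>
    rcases w with _ | ⟨y, w⟩
    · simp at hvw
    · obtain ⟨g, hg, rfl⟩ := ih w (by simpa using hvw)
      -- The diagonal copy of `g` corrects the tail, then left multiplication by `y * x⁻¹` moves the
      -- first letter `x` to `y`.
      refine ⟨rooted R (MulAction.toPermHom R R (y * x⁻¹)) * baseEmbedding R fun _ => g,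
        G.mul_mem (hR ⟨_, rfl⟩) (baseEmbedding_mem hG fun _ => hg), ?_⟩
      rw [act_mul, act_baseEmbedding_cons]
      change (y * x⁻¹ * x) :: act g v = _
      rw [inv_mul_cancel_right]

end ConstantSpinal

end SpinalTree

theorem mainTheorem10 {R : Type*} [Group R] [Finite R]
    (D G : Subgroup (SpinalTree.TreeAut R))
    (hG : SpinalTree.IsConstantSpinal G D)
    (hlayered : SpinalTree.IsLayered G) :
    SpinalTree.HasCongruenceSubgroupProperty G ↔ Group.IsPerfect G := by
  classical
  obtain ⟨hss, -, -, hpow, -⟩ := hlayered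
  rw [Group.isPerfect_def]
  constructor
  · intro hcsp
    obtain ⟨n, hn⟩ := hcsp (commutator G) inferInstance hG.finiteIndex_commutator
    exact SpinalTree.commutator_eq_top_of_layerStabilizer_le hss hpow n hn
  · refine SpinalTree.hasCongruenceSubgroupProperty_of_isPerfect hss hpow
      (SpinalTree.exists_act_eq_of_rootedGroup_le ?_ hpow)
    exact fun r hr => hG.eq_closure ▸ Subgroup.subset_closure (Or.inl hr)
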